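/- Let $a\ge 0$ and let $r,p,q:[a,\infty)\to\mathbb R$ be continuous functions with $r>0$ and $p>0$ on $[a,\infty)$ (no sign restriction on $q$). Consider the differential equation $$(r(x)y'')''-(q(x)y')'=p(x)y \qquad\text{on } [a,\infty),\tag{E}$$ understood through quasi-derivatives: with $y_1=ry''$ and $Ty=(ry'')'-qy'$, a solution is a function $y$ on $[a,\infty)$ such that $y,\ y',\ y_1,\ Ty$ are differentiable on $[a,\infty)$ (one-sidedly at $a$) and $(Ty)'=py$. The equation (E) is called systems-conjugate in $(a,\infty)$ if the systems-conjugate point $\hat\eta_1(a)$ of $a$ exists, i.e. if there is a smallest number $b\in(a,\infty)$ for which the boundary conditions $$y(a)=y_1(a)=y(b)=y_1(b)=0$$ are satisfied by a nontrivial solution $y$ of (E). Theorem. If $$\lim_{x\to\infty}\int_a^x\frac{dt}{r(t)}=+\infty\qquad\text{and}\qquad \lim_{x\to\infty}\int_a^x q(t)\,dt=-\infty,$$ then (E) is systems-conjugate in $(a,\infty)$. -/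

import Mathlib

/-!
The fourth-order equation `(r y'')'' - (q y')' = p y` on the half-line `[a, ∞)`.
All derivatives are derivatives within `[a, ∞)`, i.e. one-sided at the end point `a`.
As `r` and `q` are only continuous, the equation is understood, as is standard, through its
quasi-derivatives `y`, `y'`, `r y''`, `(r y'')' - q y'`.
-/

namespace FourthOrder

open Set

/-- The derivative of `f` within `[a, ∞)`. -/
noncomputable def der (a : ℝ) (f : ℝ → ℝ) : ℝ → ℝ :=
  derivWithin f (Ici a)

/-- The quasi-derivative `y₁ = r y''`. -/
noncomputable def quasiOne (a : ℝ) (r : ℝ → ℝ) (y : ℝ → ℝ) : ℝ → ℝ :=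
  fun x => r x * der a (der a y) x

/-- The quasi-derivative `T y = (r y'')' - q y'`. -/
noncomputable def quasiT (a : ℝ) (r q : ℝ → ℝ) (y : ℝ → ℝ) : ℝ → ℝ :=
  fun x => der a (quasiOne a r y) x - q x * der a y x

/-- `y` is a solution on `[a, ∞)` of `(r y'')'' - (q y')' = p y`: all the quasi-derivatives
are differentiable on `[a, ∞)`, and `(T y)' = p y` there. -/
structure IsSolution (a : ℝ) (r p q : ℝ → ℝ) (y : ℝ → ℝ) : Prop where
  diff_self : DifferentiableOn ℝ y (Ici a)
  diff_der : DifferentiableOn ℝ (der a y) (Ici a)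
  diff_quasiOne : DifferentiableOn ℝ (quasiOne a r y) (Ici a)
  diff_quasiT : DifferentiableOn ℝ (quasiT a r q y) (Ici a)
  equation : ∀ x ∈ Ici a, der a (quasiT a r q y) x = p x * y x

/-- The set of all `b > a` for which the boundary conditions
`y(a) = y₁(a) = y(b) = y₁(b) = 0` are satisfied by a nontrivial solution of the equation. -/
def conjugateSet (a : ℝ) (r p q : ℝ → ℝ) : Set ℝ :=
  {b | a < b ∧ ∃ y : ℝ → ℝ, IsSolution a r p q y ∧ (∃ x ∈ Ici a, y x ≠ 0) ∧
    y a = 0 ∧ quasiOne a r y a = 0 ∧ y b = 0 ∧ quasiOne a r y b = 0}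

/-- `η` is the (first) systems-conjugate point of `a`. -/
def IsSystemsConjugatePoint (a : ℝ) (r p q : ℝ → ℝ) (η : ℝ) : Prop :=
  IsLeast (conjugateSet a r p q) η

/-- The equation is systems-conjugate in `(a, ∞)`: the systems-conjugate point of `a` exists. -/
def SystemsConjugate (a : ℝ) (r p q : ℝ → ℝ) : Prop :=
  ∃ η : ℝ, IsSystemsConjugatePoint a r p q η

end FourthOrder

/-! The equation is the Euler–Lagrange equation of the energy `∫ r η''² + q η'² - p η²`. Let `u`,
`v` span the solutions with `y = y₁ = 0` at `a`. A point `b > a` is conjugate exactly when the minor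
`σ = u v₁ - v u₁` vanishes at `b`, so it suffices to find a first zero of `σ` (`conjugateSet_eq`,
`exists_zero`).

Suppose `σ > 0` on `(a, ∞)`. Then `D = u v' - v u'` satisfies `D' = σ / r` and `D a = 0`, so `D >
0`, and `riccatiForm` solves the associated Riccati equation on all of `(a, ∞)`. By Picone's
identity (`riccatiForm_sub_le`) it grows along a test function `η` by at most the energy of `η`. It
starts from `0` when `η` leaves `a` with slope `1` (`tendsto_riccatiForm`), and where `η` returns to
`0` with nonzero slope `h` it equals `σ h² / D > 0`. Hence such an `η` must have positive energy.

A test function of negative energy refutes this (`exists_nonpos`): it rises with slope `1` until `∫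
q ≤ -3` for good, flattens out, then descends to `0` with a small slope `-ε`. Divergence of `∫ 1/r`
leaves room for each change of slope at bounded cost. Since `q` is controlled only through its
primitive `Q`, the term `∫ q η'²` is integrated by parts. The term in `p` only helps and is dropped.
-/

namespace FourthOrder

open Set Filter Topology Asymptotics

/-! ### Integrating power bounds to the right of `a` -/

section Asymptotics

variable {a c : ℝ} {n : ℕ} {f f' : ℝ → ℝ}

/-- A `O((x - a) ^ n)` bound on the derivative integrates to a `O((x - a) ^ (n + 1))` bound. -/
theorem isBigO_pow_succ_of_hasDerivAt (hf : ∀ x, HasDerivAt f (f' x) x) (h0 : f a = 0)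
    (h : f' =O[𝓝[>] a] fun x => (x - a) ^ n) : f =O[𝓝[>] a] fun x => (x - a) ^ (n + 1) := by
  obtain ⟨C, hC⟩ := h.bound
  obtain ⟨b, hab, hb⟩ := mem_nhdsGT_iff_exists_Ioo_subset.1 hC
  refine IsBigO.of_bound C ?_
  filter_upwards [Ioo_mem_nhdsGT hab] with x hx
  obtain ⟨y, hy, hyx⟩ := exists_hasDerivAt_eq_slope f f' hx.1
    (fun z _ => (hf z).continuousAt.continuousWithinAt) (fun z _ => hf z)
  have hxa : 0 < x - a := sub_pos.2 hx.1
  have hya : 0 < y - a := sub_pos.2 hy.1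
  have hfx : f x = f' y * (x - a) := by rw [hyx, h0]; field_simp; ring
  have hby : ‖f' y‖ ≤ C * ‖(y - a) ^ n‖ := hb ⟨hy.1, hy.2.trans hx.2⟩
  have hC0 : 0 ≤ C := by
    by_contra hneg
    have := (norm_nonneg _).trans hby
    have h1 : 0 < ‖(y - a) ^ n‖ := norm_pos_iff.2 (pow_ne_zero _ hya.ne')
    nlinarith
  rw [hfx, norm_mul, pow_succ, norm_mul, ← mul_assoc]
  gcongr
  refine hby.trans ?_
  rw [norm_pow, norm_pow, Real.norm_of_nonneg hya.le, Real.norm_of_nonneg hxa.le]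
  gcongr
  exact hy.2.le

/-- A lower bound `c (x - a) ^ n` on the derivative integrates. -/
theorem eventually_le_of_hasDerivAt (hf : ∀ x, HasDerivAt f (f' x) x) (h0 : f a = 0)
    (h : ∀ᶠ x in 𝓝[>] a, c * (x - a) ^ n ≤ f' x) :
    ∀ᶠ x in 𝓝[>] a, c / (n + 1) * (x - a) ^ (n + 1) ≤ f x := by
  obtain ⟨b, hab, hb⟩ := mem_nhdsGT_iff_exists_Ioo_subset.1 h
  have hg : ∀ x, HasDerivAt (fun x => f x - c / (n + 1) * (x - a) ^ (n + 1))
      (f' x - c * (x - a) ^ n) x := by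
    intro x
    have h1 := (((hasDerivAt_id x).sub_const a).pow (n + 1)).const_mul (c / ((n : ℝ) + 1))
    refine ((hf x).sub h1).congr_deriv ?_
    have : (n : ℝ) + 1 ≠ 0 := by positivity
    simp
    field_simp
  filter_upwards [Ioo_mem_nhdsGT hab] with x hx
  obtain ⟨y, hy, hyx⟩ := exists_hasDerivAt_eq_slope _ _ hx.1
    (fun z _ => (hg z).continuousAt.continuousWithinAt) (fun z _ => hg z)
  have hby : c * (y - a) ^ n ≤ f' y := hb ⟨hy.1, hy.2.trans hx.2⟩
  rw [eq_div_iff (sub_pos.2 hx.1).ne'] at hyx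
  have := mul_nonneg (sub_nonneg.2 hby) (sub_pos.2 hx.1).le
  simp [h0] at hyx
  linarith

theorem isBigO_pow_zero (hf : Continuous f) :
    f =O[𝓝[>] a] fun x => (x - a) ^ 0 := by
  simpa using (hf.continuousAt (x := a)).tendsto.isBigO_one ℝ |>.mono nhdsWithin_le_nhds

theorem isBigO_continuous_mul {g : ℝ → ℝ} (hg : Continuous g)
    (hf : f =O[𝓝[>] a] fun x => (x - a) ^ n) :
    (fun x => g x * f x) =O[𝓝[>] a] fun x => (x - a) ^ n := by
  simpa using (isBigO_pow_zero (a := a) hg).mul hf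

end Asymptotics

/-- The differential and algebraic relations between the `2 × 2` minors of the matrix of
quasi-derivatives of two solutions that vanish at `a` together with `r y''`;
here `ρ = 1 / r`. -/
structure MinorSystem (a : ℝ) (ρ p q D σ E G H : ℝ → ℝ) : Prop where
  deriv_D : ∀ x, HasDerivAt D (σ x * ρ x) x
  deriv_σ : ∀ x, HasDerivAt σ (2 * E x + q x * D x) x
  deriv_E : ∀ x, HasDerivAt E (G x) x
  deriv_G : ∀ x, HasDerivAt G (H x * ρ x - p x * D x) x
  deriv_H : ∀ x, HasDerivAt H (q x * G x - p x * σ x) x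
  plucker : ∀ x, D x * H x = σ x * G x - E x ^ 2
  D_zero : D a = 0
  σ_zero : σ a = 0
  E_zero : E a = 0
  G_zero : G a = 1
  H_zero : H a = 0

/-- The quadratic form of the Riccati transform of the system. -/
noncomputable def riccatiForm (D σ E G : ℝ → ℝ) (x η h : ℝ) : ℝ :=
  (σ x * h ^ 2 - 2 * E x * η * h + G x * η ^ 2) / D x

/-! ### Behaviour of the minors near `a`, and Picone's identity -/

namespace MinorSystem

variable {a : ℝ} {ρ p q D σ E G H : ℝ → ℝ}

theorem continuous_D (S : MinorSystem a ρ p q D σ E G H) : Continuous D :=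
  continuous_iff_continuousAt.2 fun x => (S.deriv_D x).continuousAt

theorem continuous_σ (S : MinorSystem a ρ p q D σ E G H) : Continuous σ :=
  continuous_iff_continuousAt.2 fun x => (S.deriv_σ x).continuousAt

theorem continuous_E (S : MinorSystem a ρ p q D σ E G H) : Continuous E :=
  continuous_iff_continuousAt.2 fun x => (S.deriv_E x).continuousAt

theorem continuous_G (S : MinorSystem a ρ p q D σ E G H) : Continuous G :=
  continuous_iff_continuousAt.2 fun x => (S.deriv_G x).continuousAt

theorem isBigO_E (S : MinorSystem a ρ p q D σ E G H) : E =O[𝓝[>] a] fun x => (x - a) ^ 1 :=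
  isBigO_pow_succ_of_hasDerivAt S.deriv_E S.E_zero (isBigO_pow_zero S.continuous_G)

/-- A bootstrap: each pass through `σ' = 2E + qD` and `D' = σρ` gains two powers. Continuity alone
gives order 2; this makes `qD` as small as `E`, and a second pass gives order 3. -/
theorem isBigO_D (S : MinorSystem a ρ p q D σ E G H) (hρ : Continuous ρ)
    (hq : Continuous q) : D =O[𝓝[>] a] fun x => (x - a) ^ 3 := by
  have hE := S.isBigO_E
  have step : ∀ n : ℕ, (fun x => 2 * E x + q x * D x) =O[𝓝[>] a] (fun x => (x - a) ^ n) →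
      D =O[𝓝[>] a] fun x => (x - a) ^ (n + 2) := by
    intro n hn
    refine isBigO_pow_succ_of_hasDerivAt S.deriv_D S.D_zero ?_
    simpa [mul_comm] using isBigO_continuous_mul hρ (isBigO_pow_succ_of_hasDerivAt S.deriv_σ S.σ_zero hn)
  have h2 := step 0 (isBigO_pow_zero
    ((continuous_const.mul S.continuous_E).add (hq.mul S.continuous_D)))
  have hle : (fun x => (x - a) ^ 2) =O[𝓝[>] a] fun x : ℝ => (x - a) ^ 1 := by
    have h1 := isBigO_pow_zero (a := a) (continuous_id.sub continuous_const : Continuous fun x : ℝ => x - a)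
    exact (h1.mul (isBigO_refl (fun x : ℝ => (x - a) ^ 1) (𝓝[>] a))).congr
      (fun x => by simp; ring) (fun x => by ring)
  exact step 1 ((hE.const_mul_left 2).add (isBigO_continuous_mul hq (h2.trans hle)))

theorem eventually_le_σ (S : MinorSystem a ρ p q D σ E G H) (hρ : Continuous ρ)
    (hq : Continuous q) : ∀ᶠ x in 𝓝[>] a, 1 / 4 * (x - a) ^ 2 ≤ σ x := by
  have hG : ∀ᶠ x in 𝓝[>] a, (1 / 2 : ℝ) * (x - a) ^ 0 ≤ G x := by
    have : ∀ᶠ x in 𝓝 a, (1 / 2 : ℝ) < G x :=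
      (S.continuous_G.continuousAt (x := a)).eventually (lt_mem_nhds (by rw [S.G_zero]; norm_num))
    filter_upwards [nhdsWithin_le_nhds this] with x hx
    simpa using hx.le
  have hE := eventually_le_of_hasDerivAt S.deriv_E S.E_zero hG
  -- `2E` is at least `x - a` near `a`; half of this absorbs `qD`, which is of third order.
  have hqD : (fun x => q x * D x) =O[𝓝[>] a] fun x => (x - a) ^ 3 := by
    simpa using (isBigO_pow_zero (a := a) hq).mul (S.isBigO_D hρ hq)
  have hlt : Tendsto (fun x : ℝ => (x - a) ^ 2) (𝓝[>] a) (𝓝 0) := by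
    have : Continuous fun x : ℝ => (x - a) ^ 2 := by fun_prop
    simpa using (this.tendsto a).mono_left (nhdsWithin_le_nhds (s := Ioi a))
  have hlittle : (fun x : ℝ => (x - a) ^ 3) =o[𝓝[>] a] fun x => (x - a) ^ 1 := by
    have h1 := ((isLittleO_one_iff ℝ).2 hlt).mul_isBigO
      (isBigO_refl (fun x : ℝ => (x - a) ^ 1) (𝓝[>] a))
    refine h1.congr (fun x => by ring) (fun x => by ring)
  have hbd := (hqD.trans_isLittleO hlittle).bound (show (0 : ℝ) < 1 / 2 by norm_num)
  have hσ : ∀ᶠ x in 𝓝[>] a, (1 / 2 : ℝ) * (x - a) ^ 1 ≤ 2 * E x + q x * D x := by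
    filter_upwards [hE, hbd, self_mem_nhdsWithin] with x h1 h2 h3
    have hx : 0 < x - a := sub_pos.2 h3
    rw [pow_one, Real.norm_of_nonneg hx.le, Real.norm_eq_abs] at h2
    have := (abs_le.1 h2).1
    norm_num at h1 ⊢
    linarith
  have := eventually_le_of_hasDerivAt S.deriv_σ S.σ_zero hσ
  filter_upwards [this] with x hx
  norm_num at hx
  linarith

theorem eventually_le_D (S : MinorSystem a ρ p q D σ E G H) (hρ : Continuous ρ)
    (hq : Continuous q) (hρ_pos : 0 < ρ a) :
    ∀ᶠ x in 𝓝[>] a, ρ a / 24 * (x - a) ^ 3 ≤ D x := by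
  have h1 : ∀ᶠ x in 𝓝[>] a, ρ a / 2 < ρ x :=
    nhdsWithin_le_nhds ((hρ.continuousAt (x := a)).eventually (lt_mem_nhds (by linarith)))
  have h2 : ∀ᶠ x in 𝓝[>] a, ρ a / 8 * (x - a) ^ 2 ≤ σ x * ρ x := by
    filter_upwards [h1, S.eventually_le_σ hρ hq] with x hx hσ
    calc ρ a / 8 * (x - a) ^ 2 = 1 / 4 * (x - a) ^ 2 * (ρ a / 2) := by ring
      _ ≤ σ x * ρ x := by gcongr; exact (by positivity : (0:ℝ) ≤ 1 / 4 * (x - a) ^ 2).trans hσ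
  filter_upwards [eventually_le_of_hasDerivAt S.deriv_D S.D_zero h2] with x hx
  norm_num at hx
  linarith

/-- The form is singular at `a`, with `D` of exact order 3 there. Along `η = x - a` the numerator is
nevertheless of order 4, so the quotient is `O(x - a)`. -/
theorem tendsto_riccatiForm (S : MinorSystem a ρ p q D σ E G H) (hρ : Continuous ρ)
    (hp : Continuous p) (hq : Continuous q) (hρ_pos : 0 < ρ a) :
    Tendsto (fun x => riccatiForm D σ E G x (x - a) 1) (𝓝[>] a) (𝓝 0) := by
  have hD := S.isBigO_D hρ hq
  have hH : H =O[𝓝[>] a] fun x => (x - a) ^ 1 :=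
    isBigO_pow_succ_of_hasDerivAt S.deriv_H S.H_zero
      (isBigO_pow_zero ((hq.mul S.continuous_G).sub (hp.mul S.continuous_σ)))
  -- In the derivative of the numerator all terms in `E` and `G` cancel; what remains contains `D`
  -- or `H (x - a)²`, all of third order.
  have hN : ∀ x, HasDerivAt (fun x => σ x - 2 * E x * (x - a) + G x * (x - a) ^ 2)
      (q x * D x + (ρ x * (H x * (x - a) ^ 2) - ((x - a) ^ 2 * p x) * D x)) x := by
    intro x
    have h1 := (hasDerivAt_id x).sub_const a
    have h2 := ((S.deriv_σ x).sub (((S.deriv_E x).const_mul 2).mul h1)).add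
      ((S.deriv_G x).mul (h1.pow 2))
    refine h2.congr_deriv ?_
    simp
    ring
  have hN4 : (fun x => σ x - 2 * E x * (x - a) + G x * (x - a) ^ 2) =O[𝓝[>] a]
      fun x => (x - a) ^ 4 := by
    refine isBigO_pow_succ_of_hasDerivAt hN (by simp [S.σ_zero]) ?_
    refine (isBigO_continuous_mul hq hD).add ((isBigO_continuous_mul hρ ?_).sub (isBigO_continuous_mul (by fun_prop) hD))
    refine (hH.mul (isBigO_refl (fun x : ℝ => (x - a) ^ 2) _)).congr_right fun x => by ring
  have hlow := S.eventually_le_D hρ hq hρ_pos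
  have h3 : (fun x : ℝ => (x - a) ^ 3) =O[𝓝[>] a] D := by
    refine IsBigO.of_bound (24 / ρ a) ?_
    filter_upwards [hlow, self_mem_nhdsWithin] with x hx hxa
    have hx3 : 0 < (x - a) ^ 3 := pow_pos (sub_pos.2 hxa) 3
    have hDx : 0 < D x := (by positivity : 0 < ρ a / 24 * (x - a) ^ 3).trans_le hx
    rw [Real.norm_of_nonneg hx3.le, Real.norm_of_nonneg hDx.le]
    rw [div_mul_eq_mul_div, le_div_iff₀ hρ_pos]
    linarith
  have h4 : (fun x : ℝ => (x - a) ^ 4) =O[𝓝[>] a] fun x => (x - a) * D x :=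
    ((isBigO_refl (fun x : ℝ => x - a) _).mul h3).congr_left fun x => by ring
  have h5 := (hN4.trans h4).mul (isBigO_refl (fun x => (D x)⁻¹) (𝓝[>] a))
  have h6 : Tendsto (fun x : ℝ => x - a) (𝓝[>] a) (𝓝 0) := by
    have : Continuous fun x : ℝ => x - a := by fun_prop
    simpa using (this.tendsto a).mono_left (nhdsWithin_le_nhds (s := Ioi a))
  refine (h5.congr' (g₂ := fun x => x - a) ?_ ?_).trans_tendsto h6
  · filter_upwards with x
    simp [riccatiForm, div_eq_mul_inv]
  · filter_upwards [hlow, self_mem_nhdsWithin] with x hx hxa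
    have hx3 : 0 < (x - a) ^ 3 := pow_pos (sub_pos.2 hxa) 3
    have hDx : 0 < D x := (by positivity : 0 < ρ a / 24 * (x - a) ^ 3).trans_le hx
    field_simp

/-- Picone's identity, integrated by parts: along a function `η` with `η' = h`, `r h' = k`, the
form `riccatiForm` minus explicit boundary terms is nonincreasing. -/
theorem riccatiForm_sub_le (S : MinorSystem a ρ p q D σ E G H) {Q η h : ℝ → ℝ} {k l s t : ℝ}
    (hρ : ∀ x, 0 < ρ x) (hp : ∀ x, 0 < p x)
    (hQ : ∀ x, HasDerivAt Q (q x) x) (hη : ∀ x, HasDerivAt η (h x) x)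
    (hh : ∀ x, HasDerivAt h (k * ρ x) x) (hst : s ≤ t) (hD : ∀ x ∈ Icc s t, 0 < D x)
    (hl : ∀ x ∈ Icc s t, 0 ≤ (Q x + l) * (h x * k)) :
    riccatiForm D σ E G t (η t) (h t) - Q t * h t ^ 2 - k * h t - l * h t ^ 2 ≤
      riccatiForm D σ E G s (η s) (h s) - Q s * h s ^ 2 - k * h s - l * h s ^ 2 := by
  have hder : ∀ x ∈ Icc s t, HasDerivAt
      (fun x => riccatiForm D σ E G x (η x) (h x) - Q x * h x ^ 2 - k * h x - l * h x ^ 2)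
      (-(ρ x * ((σ x * h x - E x * η x) / D x - k) ^ 2) - p x * η x ^ 2
        - 2 * ρ x * ((Q x + l) * (h x * k))) x := by
    intro x hx
    have hDx := (hD x hx).ne'
    have h1 := (((((S.deriv_σ x).mul ((hh x).pow 2)).sub
      ((((S.deriv_E x).const_mul 2).mul (hη x)).mul (hh x))).add
      ((S.deriv_G x).mul ((hη x).pow 2))).div (S.deriv_D x) hDx)
    have h2 := ((h1.sub ((hQ x).mul ((hh x).pow 2))).sub ((hh x).const_mul k)).sub
      (((hh x).pow 2).const_mul l)
    refine h2.congr_deriv ?_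
    -- Eliminating `H` by the Plücker relation is what completes the square.
    have hH : H x = (σ x * G x - E x ^ 2) / D x := by
      rw [eq_div_iff hDx, mul_comm]; exact S.plucker x
    simp only [Pi.mul_apply, Pi.pow_apply, Pi.add_apply, Pi.sub_apply]
    rw [hH]
    field_simp
    push_cast
    ring
  have hanti := antitoneOn_of_deriv_nonpos (convex_Icc s t)
    (fun x hx => (hder x hx).continuousAt.continuousWithinAt)
    (fun x hx => (hder x (interior_subset hx)).differentiableAt.differentiableWithinAt)
    (fun x hx => by
      rw [(hder x (interior_subset hx)).deriv]
      have h1 := mul_nonneg (hρ x).le (sq_nonneg ((σ x * h x - E x * η x) / D x - k))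
      have h2 := mul_nonneg (hp x).le (sq_nonneg (η x))
      have h3 := mul_nonneg (hρ x).le (hl x (interior_subset hx))
      linarith)
  exact hanti (left_mem_Icc.2 hst) (right_mem_Icc.2 hst) hst

end MinorSystem

/-- A continuous function tending to `-∞` has arbitrarily late running minima. -/
theorem exists_gt_forall_le_of_tendsto_atBot {Q : ℝ → ℝ} (hQ : Continuous Q)
    (hlim : Tendsto Q atTop atBot) {m C : ℝ} (hmC : m ≤ C) :
    ∃ c, C < c ∧ ∀ x ∈ Icc m c, Q c ≤ Q x := by
  obtain ⟨y, hy, hmin⟩ := isCompact_Icc.exists_isMinOn (nonempty_Icc.2 hmC) hQ.continuousOn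
  -- At `X` the function is below its minimum over `[m, C]`, so the minimum over `[m, X]` is
  -- attained after `C`.
  obtain ⟨X, hX, hCX⟩ := ((hlim.eventually (eventually_lt_atBot (Q y))).and
    (eventually_gt_atTop C)).exists
  obtain ⟨c, hc, hcmin⟩ := isCompact_Icc.exists_isMinOn
    (nonempty_Icc.2 (hmC.trans hCX.le)) (hQ.continuousOn (s := Icc m X))
  refine ⟨c, ?_, fun x hx => hcmin ⟨hx.1, hx.2.trans hc.2⟩⟩
  by_contra! hcC
  have h1 : Q y ≤ Q c := hmin ⟨hc.1, hcC⟩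
  have h2 : Q c ≤ Q X := hcmin ⟨hmC.trans hCX.le, le_rfl⟩
  linarith

/-! ### The test function of negative energy and the first zero of `σ` -/

namespace MinorSystem

variable {a : ℝ} {ρ p q D σ E G H : ℝ → ℝ}

theorem D_pos (S : MinorSystem a ρ p q D σ E G H) (hρ : ∀ x, 0 < ρ x)
    (hσ : ∀ x, a < x → 0 < σ x) {x : ℝ} (hx : a < x) : 0 < D x := by
  have := strictMonoOn_of_deriv_pos (convex_Ici a) S.continuous_D.continuousOn (fun y hy => by
    rw [interior_Ici] at hy
    rw [(S.deriv_D y).deriv]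
    exact mul_pos (hσ y hy) (hρ y))
  rw [← S.D_zero]
  exact this self_mem_Ici hx.le hx

theorem exists_nonpos (S : MinorSystem a ρ p q D σ E G H) {Q R : ℝ → ℝ}
    (hρ : Continuous ρ) (hp : Continuous p) (hq : Continuous q)
    (hρ_pos : ∀ x, 0 < ρ x) (hp_pos : ∀ x, 0 < p x)
    (hQ : ∀ x, HasDerivAt Q (q x) x) (hR : ∀ x, HasDerivAt R (ρ x) x) (hQa : Q a = 0)
    (hQ_lim : Tendsto Q atTop atBot) (hR_lim : Tendsto R atTop atTop) :
    ∃ x, a < x ∧ σ x ≤ 0 := by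
  by_contra! hσ
  have hD : ∀ x, a < x → 0 < D x := fun x hx => S.D_pos hρ_pos hσ hx
  have hQc : Continuous Q := continuous_iff_continuousAt.2 fun x => (hQ x).continuousAt
  have hRc : Continuous R := continuous_iff_continuousAt.2 fun x => (hR x).continuousAt
  have hRm : StrictMono R := strictMono_of_deriv_pos fun x => by rw [(hR x).deriv]; exact hρ_pos x
  have hRsurj : ∀ x, ∃ y, x < y ∧ R y = R x + 1 := by
    intro x
    obtain ⟨X, hX, hxX⟩ := ((hR_lim.eventually_ge_atTop (R x + 1)).and
      (eventually_ge_atTop x)).exists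
    obtain ⟨y, hy, hyR⟩ := intermediate_value_Icc hxX hRc.continuousOn
      (show R x + 1 ∈ Icc (R x) (R X) from ⟨by linarith, hX⟩)
    exact ⟨y, hRm.lt_iff_lt.1 (by linarith), hyR⟩
  -- The bound `-3` pays for flattening the slope, which costs `∫ ρ = 1`, and for the descent, which
  -- costs `ε² < 1`.
  obtain ⟨b, hb, hab⟩ := ((eventually_atTop.1 (hQ_lim.eventually_le_atBot (-3))).imp
    fun b h x hx => h x hx : ∃ b, ∀ x ≥ b, Q x ≤ -3) |>.elim fun b h =>
    (⟨max b (a + 1), fun x hx => h x ((le_max_left _ _).trans hx),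
      (lt_add_one a).trans_le (le_max_right _ _)⟩ : ∃ b, (∀ x ≥ b, Q x ≤ -3) ∧ a < b)
  -- A slope that is affine in `R` has constant `r h'`; an increment `1` of `R` changes it by
  -- exactly that constant.
  obtain ⟨m, hbm, hm⟩ := hRsurj b
  obtain ⟨m', hmm', hm'⟩ := hRsurj m
  -- the rising part, with slope `1`
  have hb_le : riccatiForm D σ E G b (b - a) 1 ≤ Q b := by
    have hlim : Tendsto (fun s => riccatiForm D σ E G s (s - a) 1 - Q s) (𝓝[>] a) (𝓝 0) := by
      have h1 := (hQc.tendsto a).mono_left (nhdsWithin_le_nhds (s := Ioi a))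
      simpa [hQa] using (S.tendsto_riccatiForm hρ hp hq (hρ_pos a)).sub h1
    have := ge_of_tendsto hlim (b := riccatiForm D σ E G b (b - a) 1 - Q b) (by
      filter_upwards [Ioo_mem_nhdsGT hab] with s hs
      simpa using S.riccatiForm_sub_le (Q := Q) (η := fun x => x - a) (h := fun _ => 1) (k := 0)
        (l := 0) (s := s) (t := b) hρ_pos hp_pos hQ (fun x => (hasDerivAt_id x).sub_const a)
        (fun x => by simpa using hasDerivAt_const x (1 : ℝ)) hs.2.le
        (fun x hx => hD x (hs.1.trans_le hx.1)) (by simp))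
    linarith
  -- the slope decreases to `0`
  obtain ⟨A, hA, hm_le⟩ : ∃ A, 0 < A ∧ riccatiForm D σ E G m A 0 ≤ -2 := by
    have hcont : Continuous fun x => 1 - (R x - R b) := by fun_prop
    have hη : ∀ x, HasDerivAt (fun x => (b - a) + ∫ t in b..x, (1 - (R t - R b)))
        (1 - (R x - R b)) x := fun x =>
      (hcont.integral_hasStrictDerivAt b x).hasDerivAt.const_add _
    refine ⟨(b - a) + ∫ t in b..m, (1 - (R t - R b)), ?_, ?_⟩
    · have : 0 ≤ ∫ t in b..m, (1 - (R t - R b)) :=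
        intervalIntegral.integral_nonneg hbm.le fun x hx => by
          have := hRm.monotone hx.2
          linarith
      linarith
    -- With `l = 3` the factor `Q + l` is nonpositive, as is `h k`. The boundary terms at `m` vanish
    -- with `h`; those at `b` contribute `1 - 3` besides `-Q b`.
    · have := S.riccatiForm_sub_le (k := -1) (l := 3) hρ_pos hp_pos hQ hη
        (fun x => (((hR x).sub_const (R b)).const_sub 1).congr_deriv (by ring)) hbm.le
        (fun x hx => hD x (hab.trans_le hx.1)) (fun x hx => by
          have h1 := hb x hx.1
          have h2 := hRm.monotone hx.2
          exact mul_nonneg_of_nonpos_of_nonpos (by linarith) (by linarith))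
      simp [hm] at this
      linarith
  -- the slope decreases to `-ε` and stays there until `η` vanishes
  obtain ⟨c, hc, hcmin⟩ := exists_gt_forall_le_of_tendsto_atBot hQc hQ_lim
    (show m ≤ m' + A by linarith)
  set P : ℝ → ℝ := fun x => ∫ t in m..x, (R t - R m) with hP
  have hPder : ∀ x, HasDerivAt P (R x - R m) x := fun x =>
    ((by fun_prop : Continuous fun t => R t - R m).integral_hasStrictDerivAt m x).hasDerivAt
  have hPm : P m = 0 := intervalIntegral.integral_same
  have hPm' : 0 ≤ P m' := intervalIntegral.integral_nonneg hmm'.le fun x hx =>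
    sub_nonneg.2 (hRm.monotone hx.1)
  have hB : A < P m' + (c - m') := by linarith
  -- This slope brings `η` from height `A` to `0` exactly at `c`; taking `c` beyond `m' + A` makes
  -- it less than `1`.
  set ε : ℝ := A / (P m' + (c - m')) with hε
  have hε0 : 0 < ε := div_pos hA (hA.trans hB)
  have hε1 : ε < 1 := (div_lt_one (hA.trans hB)).2 hB
  have hεA : ε * (P m' + (c - m')) = A := div_mul_cancel₀ _ (hA.trans hB).ne'
  -- With `l = -Q c`, minimality of `Q` at `c` gives `Q + l ≥ 0`, matching `h k ≥ 0`. The boundary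
  -- term `Q c * ε²` then cancels the one from the last piece, however negative `Q c` is.
  have h3 := S.riccatiForm_sub_le (k := -ε) (l := -Q c) (η := fun x => A - ε * P x)
    (h := fun x => -ε * (R x - R m)) hρ_pos hp_pos hQ
    (fun x => (((hPder x).const_mul ε).const_sub A).congr_deriv (by ring))
    (fun x => ((hR x).sub_const (R m)).const_mul (-ε)) hmm'.le
    (fun x hx => hD x (by linarith [hx.1])) (fun x hx => by
      have h1 := hcmin x ⟨hx.1, by linarith [hx.2]⟩
      have h2 := hRm.monotone hx.1
      refine mul_nonneg (by linarith) (mul_nonneg_of_nonpos_of_nonpos ?_ (by linarith))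
      exact mul_nonpos_of_nonpos_of_nonneg (by linarith) (by linarith))
  have h4 := S.riccatiForm_sub_le (k := 0) (l := 0) (η := fun x => A - ε * P m' - ε * (x - m'))
    (h := fun _ => -ε) (s := m') (t := c) hρ_pos hp_pos hQ
    (fun x => ((((hasDerivAt_id x).sub_const m').const_mul ε).const_sub _).congr_deriv (by ring))
    (fun x => by simpa using hasDerivAt_const x (-ε)) (by linarith)
    (fun x hx => hD x (by linarith [hx.1])) (by simp)
  have hc0 : A - ε * P m' - ε * (c - m') = 0 := by rw [← hεA]; ring
  have h5 : 0 < riccatiForm D σ E G c 0 (-ε) := by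
    have hac : a < c := by linarith
    have h6 := hσ c hac
    have h7 := hD c hac
    simp only [riccatiForm]
    norm_num
    positivity
  simp only [hm', hPm, hc0] at h3 h4
  simp only [add_sub_cancel_left, sub_self, mul_zero, mul_one, sub_zero, zero_mul] at h3 h4
  norm_num at h3 h4
  -- The three pieces add up to a value of at most `-2 + ε² < 0` at `c`, against `h5`.
  nlinarith

theorem exists_zero (S : MinorSystem a ρ p q D σ E G H) {Q R : ℝ → ℝ}
    (hρ : Continuous ρ) (hp : Continuous p) (hq : Continuous q)
    (hρ_pos : ∀ x, 0 < ρ x) (hp_pos : ∀ x, 0 < p x)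
    (hQ : ∀ x, HasDerivAt Q (q x) x) (hR : ∀ x, HasDerivAt R (ρ x) x) (hQa : Q a = 0)
    (hQ_lim : Tendsto Q atTop atBot) (hR_lim : Tendsto R atTop atTop) :
    ∃ η, IsLeast {x | a < x ∧ σ x = 0} η := by
  obtain ⟨d, had, hd⟩ := mem_nhdsGT_iff_exists_Ioo_subset.1 (S.eventually_le_σ hρ hq)
  have hpos : ∀ x ∈ Ioo a d, 0 < σ x := fun x hx =>
    (mul_pos (by norm_num) (pow_pos (sub_pos.2 hx.1) 2)).trans_le (hd hx)
  obtain ⟨x, hax, hx⟩ := S.exists_nonpos hρ hp hq hρ_pos hp_pos hQ hR hQa hQ_lim hR_lim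
  -- The zero of `σ` at `a` itself is isolated from the right, so the zeros beyond `a` form a closed
  -- set and the infimum is attained.
  have hset : {x | a < x ∧ σ x = 0} = Ici d ∩ σ ⁻¹' {0} := by
    ext y
    simp only [mem_ofPred_eq, mem_inter_iff, mem_Ici, mem_preimage, mem_singleton_iff]
    refine and_congr_left fun hy => ⟨fun h => ?_, fun h => lt_of_lt_of_le had h⟩
    by_contra! hlt
    exact (hpos y ⟨h, hlt⟩).ne' hy
  obtain ⟨y, hay, hyd⟩ := exists_between (lt_min had hax)
  obtain ⟨z, hz, hz0⟩ := intermediate_value_Icc' (hyd.le.trans (min_le_right _ _))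
    S.continuous_σ.continuousOn ⟨hx, (hpos y ⟨hay, hyd.trans_le (min_le_left _ _)⟩).le⟩
  have hne : {x | a < x ∧ σ x = 0}.Nonempty := ⟨z, hay.trans_le hz.1, hz0⟩
  rw [hset] at hne ⊢
  exact ⟨_, (isClosed_Ici.inter (isClosed_singleton.preimage S.continuous_σ)).isLeast_csInf hne
    (BddBelow.inter_of_left bddBelow_Ici)⟩

end MinorSystem

end FourthOrder

namespace FourthOrder

open Set Filter Topology

/-! ### Linear systems: global existence and uniqueness -/

section LinearODE

variable {V : Type*} [NormedAddCommGroup V] [NormedSpace ℝ V]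

/-- The terms of the Picard series of the linear equation `X' = A X`, `X a = x₀`. -/
noncomputable def picardTerm (a : ℝ) (A : ℝ → V →L[ℝ] V) (x₀ : V) : ℕ → ℝ → V
  | 0 => fun _ => x₀
  | n + 1 => fun t => ∫ s in a..t, A s (picardTerm a A x₀ n s)

variable {a : ℝ} {A : ℝ → V →L[ℝ] V} {x₀ : V}

theorem continuous_picardTerm (hA : Continuous A) (n : ℕ) :
    Continuous (picardTerm a A x₀ n) := by
  induction n with
  | zero => exact continuous_const
  | succ n ih =>
    exact intervalIntegral.continuous_primitive (μ := MeasureTheory.volume)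
      (fun _ _ => (hA.clm_apply ih).intervalIntegrable _ _) a

theorem hasDerivAt_picardTerm_succ [CompleteSpace V] (hA : Continuous A) (n : ℕ) (t : ℝ) :
    HasDerivAt (picardTerm a A x₀ (n + 1)) (A t (picardTerm a A x₀ n t)) t :=
  ((hA.clm_apply (continuous_picardTerm hA n)).integral_hasStrictDerivAt a t).hasDerivAt

/-- The factorial from iterated integration beats every `K` and `T`, so the Picard series converges
on every bounded interval and the solution is global. -/
theorem norm_picardTerm_le {K T : ℝ} (hK : ∀ s, |s - a| ≤ T → ‖A s‖ ≤ K) (n : ℕ) {t : ℝ}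
    (ht : |t - a| ≤ T) :
    ‖picardTerm a A x₀ n t‖ ≤ ‖x₀‖ * ((K * |t - a|) ^ n / n.factorial) := by
  induction n generalizing t with
  | zero => simp [picardTerm]
  | succ n ih =>
    have hK0 : 0 ≤ K := (norm_nonneg _).trans (hK t ht)
    have hbd : ∀ s ∈ uIoc a t, ‖A s (picardTerm a A x₀ n s)‖ ≤
        K ^ (n + 1) * ‖x₀‖ / n.factorial * |s - a| ^ n := by
      intro s hs
      have hs' : |s - a| ≤ T := (abs_sub_left_of_mem_uIcc (uIoc_subset_uIcc hs)).trans ht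
      calc ‖A s (picardTerm a A x₀ n s)‖ ≤ ‖A s‖ * ‖picardTerm a A x₀ n s‖ := (A s).le_opNorm _
        _ ≤ K * (‖x₀‖ * ((K * |s - a|) ^ n / n.factorial)) := by
          gcongr
          · exact hK s hs'
          · exact ih hs'
        _ = K ^ (n + 1) * ‖x₀‖ / n.factorial * |s - a| ^ n := by rw [mul_pow]; ring
    have h1 := intervalIntegral.norm_integral_le_abs_of_norm_le (μ := MeasureTheory.volume)
      ((MeasureTheory.ae_restrict_mem measurableSet_uIoc).mono hbd)
      (by apply Continuous.intervalIntegrable; fun_prop)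
    refine h1.trans (le_of_eq ?_)
    have h2 : |∫ s in a..t, |s - a| ^ n| = |t - a| ^ (n + 1) / (n + 1) := by
      rw [intervalIntegral.abs_intervalIntegral_eq, integral_pow_abs_sub_uIoc]
      exact abs_of_nonneg (by positivity)
    rw [intervalIntegral.integral_const_mul, abs_mul, h2, abs_of_nonneg (by positivity),
      Nat.factorial_succ, mul_pow]
    push_cast
    field_simp

/-- Global existence for linear differential equations with continuous coefficients. -/
theorem exists_hasDerivAt_linear [CompleteSpace V] (a : ℝ) (hA : Continuous A) (x₀ : V) :
    ∃ X : ℝ → V, X a = x₀ ∧ ∀ t, HasDerivAt X (A t (X t)) t := by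
  have hloc : ∀ t, HasDerivAt (fun t => ∑' n, picardTerm a A x₀ n t)
      (A t (∑' n, picardTerm a A x₀ n t)) t := by
    intro t
    set T : ℝ := |t - a| + 1
    obtain ⟨K, hK⟩ := (isCompact_closedBall a T).exists_bound_of_continuousOn hA.continuousOn
    have hK' : ∀ s, |s - a| ≤ T → ‖A s‖ ≤ K := fun s hs => hK s (by
      rwa [Metric.mem_closedBall, Real.dist_eq])
    have hK0 : 0 ≤ K := (norm_nonneg _).trans (hK' t (by simp [T]))
    have hsum : Summable fun n : ℕ => ‖x₀‖ * ((K * T) ^ n / n.factorial) :=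
      (Real.summable_pow_div_factorial _).mul_left _
    have hnorm : ∀ n s, s ∈ Metric.ball a T →
        ‖picardTerm a A x₀ n s‖ ≤ ‖x₀‖ * ((K * T) ^ n / n.factorial) := by
      intro n s hs
      have hs' : |s - a| ≤ T := (Metric.mem_ball.1 hs).le
      refine (norm_picardTerm_le hK' n hs').trans ?_
      gcongr
    have hsummable : ∀ s ∈ Metric.ball a T, Summable fun n => picardTerm a A x₀ n s :=
      fun s hs => Summable.of_norm_bounded hsum fun n => hnorm n s hs
    have ht : t ∈ Metric.ball a T := by simp [T, Real.dist_eq]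
    have hder := hasDerivAt_tsum_of_isPreconnected (hsum.mul_left K) Metric.isOpen_ball
      (convex_ball a T).isPreconnected
      (g := fun n => picardTerm a A x₀ (n + 1)) (g' := fun n s => A s (picardTerm a A x₀ n s))
      (fun n s _ => hasDerivAt_picardTerm_succ hA n s)
      (fun n s hs => ((A s).le_opNorm _).trans
        (mul_le_mul (hK' s (Metric.mem_ball.1 hs).le) (hnorm n s hs) (norm_nonneg _) hK0))
      ht ((summable_nat_add_iff 1).2 (hsummable t ht)) ht
    -- Differentiation shifts the series by one term, so the derivative of the tail is `A t` applied
    -- to the whole series.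
    rw [← (A t).map_tsum (hsummable t ht)] at hder
    refine (hder.const_add x₀).congr_of_eventuallyEq ?_
    filter_upwards [Metric.isOpen_ball.mem_nhds ht] with s hs
    exact (hsummable s hs).tsum_eq_zero_add
  refine ⟨_, ?_, hloc⟩
  rw [tsum_eq_single 0 (fun n hn => ?_)]
  · rfl
  · obtain ⟨k, rfl⟩ := Nat.exists_eq_succ_of_ne_zero hn
    exact intervalIntegral.integral_same

/-- A solution of a linear differential equation that vanishes at `a` vanishes on `[a, ∞)`. -/
theorem eq_zero_of_hasDerivWithinAt_linear (hA : Continuous A) {X : ℝ → V}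
    (hX : ∀ t ∈ Ici a, HasDerivWithinAt X (A t (X t)) (Ici a) t) (h0 : X a = 0) :
    ∀ t ∈ Ici a, X t = 0 := by
  intro t ht
  obtain ⟨K, hK⟩ := (isCompact_Icc (a := a) (b := t)).exists_bound_of_continuousOn hA.continuousOn
  exact eq_zero_of_abs_deriv_le_mul_abs_self_of_eq_zero_right (K := K) (a := a) (b := t)
    (fun s hs => (hX s hs.1).continuousWithinAt.mono Icc_subset_Ici_self)
    (fun s hs => (hX s hs.1).mono (Ici_subset_Ici.2 hs.1)) h0
    (fun s hs => ((A s).le_opNorm _).trans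
      (by gcongr; exact hK s ⟨hs.1, hs.2.le⟩)) t ⟨ht, le_rfl⟩

end LinearODE

end FourthOrder

namespace FourthOrder

/-! ### The equation as a first order system, and its conjugate points -/

open Set Filter Topology

/-- The elementary matrix with a single entry `1` in row `i` and column `j`, as an operator. -/
noncomputable def entry (i j : Fin 4) : (Fin 4 → ℝ) →L[ℝ] (Fin 4 → ℝ) :=
  (ContinuousLinearMap.proj j).smulRight (Pi.single i 1)

/-- The coefficient of the first order system satisfied by `(y, y', y₁, T y)`, with `ρ = 1 / r`. -/
noncomputable def systemOp (ρ p q : ℝ → ℝ) (t : ℝ) : (Fin 4 → ℝ) →L[ℝ] (Fin 4 → ℝ) :=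
  entry 0 1 + ρ t • entry 1 2 + entry 2 3 + q t • entry 2 1 + p t • entry 3 0

theorem systemOp_apply (ρ p q : ℝ → ℝ) (t : ℝ) (X : Fin 4 → ℝ) :
    systemOp ρ p q t X = ![X 1, ρ t * X 2, X 3 + q t * X 1, p t * X 0] := by
  ext i
  fin_cases i <;> simp [systemOp, entry]

theorem continuous_systemOp {ρ p q : ℝ → ℝ} (hρ : Continuous ρ) (hp : Continuous p)
    (hq : Continuous q) : Continuous (systemOp ρ p q) := by
  unfold systemOp
  fun_prop

variable {a : ℝ} {r p q ρ p' q' : ℝ → ℝ}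

/-- The vector of quasi-derivatives of `y`. -/
noncomputable def quasiVec (a : ℝ) (r q y : ℝ → ℝ) (x : ℝ) : Fin 4 → ℝ :=
  ![y x, der a y x, quasiOne a r y x, quasiT a r q y x]

theorem IsSolution.hasDerivWithinAt_quasiVec {y : ℝ → ℝ} (hy : IsSolution a r p q y)
    (hr : ∀ x ∈ Ici a, 0 < r x) (hρ : ∀ x ∈ Ici a, ρ x = 1 / r x)
    (hp : ∀ x ∈ Ici a, p' x = p x) (hq : ∀ x ∈ Ici a, q' x = q x) {x : ℝ} (hx : x ∈ Ici a) :
    HasDerivWithinAt (quasiVec a r q y) (systemOp ρ p' q' x (quasiVec a r q y x)) (Ici a) x := by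
  rw [systemOp_apply, hasDerivWithinAt_pi]
  intro i
  fin_cases i
  · exact (hy.diff_self x hx).hasDerivWithinAt
  · refine (hy.diff_der x hx).hasDerivWithinAt.congr_deriv ?_
    have := (hr x hx).ne'
    simp [quasiVec, quasiOne, hρ x hx, der]
    field_simp
  · refine (hy.diff_quasiOne x hx).hasDerivWithinAt.congr_deriv ?_
    simp [quasiVec, quasiT, hq x hx, der]
  · refine (hy.diff_quasiT x hx).hasDerivWithinAt.congr_deriv ?_
    simpa [quasiVec, hp x hx, der] using hy.equation x hx

theorem isSolution_of_hasDerivAt {X : ℝ → Fin 4 → ℝ}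
    (hX : ∀ x, HasDerivAt X (systemOp ρ p' q' x (X x)) x)
    (hr : ∀ x ∈ Ici a, 0 < r x) (hρ : ∀ x ∈ Ici a, ρ x = 1 / r x)
    (hp : ∀ x ∈ Ici a, p' x = p x) (hq : ∀ x ∈ Ici a, q' x = q x) :
    IsSolution a r p q (fun x => X x 0) ∧
      EqOn (quasiVec a r q fun x => X x 0) X (Ici a) := by
  have hd : ∀ i x, HasDerivWithinAt (fun x => X x i) (systemOp ρ p' q' x (X x) i) (Ici a) x :=
    fun i x => (hasDerivAt_pi.1 (hX x) i).hasDerivWithinAt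
  have hder : ∀ {f : ℝ → ℝ} (i : Fin 4), EqOn f (fun x => X x i) (Ici a) →
      DifferentiableOn ℝ f (Ici a) ∧
        ∀ x ∈ Ici a, der a f x = systemOp ρ p' q' x (X x) i := by
    intro f i hf
    have h1 : ∀ x ∈ Ici a, HasDerivWithinAt f (systemOp ρ p' q' x (X x) i) (Ici a) x :=
      fun x hx => (hd i x).congr hf (hf hx)
    exact ⟨fun x hx => (h1 x hx).differentiableWithinAt,
      fun x hx => (h1 x hx).derivWithin (uniqueDiffOn_Ici a x hx)⟩
  obtain ⟨d0, e0⟩ := hder (f := fun x => X x 0) 0 (fun _ _ => rfl)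
  have h1 : EqOn (der a fun x => X x 0) (fun x => X x 1) (Ici a) := fun x hx => by
    simp [e0 x hx, systemOp_apply]
  obtain ⟨d1, e1⟩ := hder 1 h1
  have h2 : EqOn (quasiOne a r fun x => X x 0) (fun x => X x 2) (Ici a) := fun x hx => by
    have := (hr x hx).ne'
    simp [quasiOne, e1 x hx, systemOp_apply, hρ x hx]
    field_simp
  obtain ⟨d2, e2⟩ := hder 2 h2
  have h3 : EqOn (quasiT a r q fun x => X x 0) (fun x => X x 3) (Ici a) := fun x hx => by
    simp [quasiT, e2 x hx, h1 hx, systemOp_apply, hq x hx]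
  obtain ⟨d3, e3⟩ := hder 3 h3
  refine ⟨⟨d0, d1, d2, d3, fun x hx => ?_⟩, fun x hx => ?_⟩
  · simp [e3 x hx, systemOp_apply, hp x hx]
  · ext i
    fin_cases i
    · rfl
    · exact h1 hx
    · exact h2 hx
    · exact h3 hx

theorem minorSystem_of_hasDerivAt {u v : ℝ → Fin 4 → ℝ}
    (hu : ∀ x, HasDerivAt u (systemOp ρ p q x (u x)) x)
    (hv : ∀ x, HasDerivAt v (systemOp ρ p q x (v x)) x)
    (hua : u a = ![0, 1, 0, 0]) (hva : v a = ![0, 0, 0, 1]) :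
    MinorSystem a ρ p q (fun x => u x 0 * v x 1 - v x 0 * u x 1)
      (fun x => u x 0 * v x 2 - v x 0 * u x 2) (fun x => u x 1 * v x 2 - v x 1 * u x 2)
      (fun x => u x 1 * v x 3 - v x 1 * u x 3) (fun x => u x 2 * v x 3 - v x 2 * u x 3) := by
  have hmin : ∀ i j x, HasDerivAt (fun x => u x i * v x j - v x i * u x j)
      ((systemOp ρ p q x (u x) i * v x j + u x i * systemOp ρ p q x (v x) j) -
        (systemOp ρ p q x (v x) i * u x j + v x i * systemOp ρ p q x (u x) j)) x := fun i j x =>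
    ((hasDerivAt_pi.1 (hu x) i).mul (hasDerivAt_pi.1 (hv x) j)).sub
      ((hasDerivAt_pi.1 (hv x) i).mul (hasDerivAt_pi.1 (hu x) j))
  simp only [systemOp_apply] at hmin
  -- Self-adjointness: the Lagrange bracket of two solutions is constant, and here it vanishes at
  -- `a`. This leaves five independent minors out of six.
  have hiso : ∀ x, u x 0 * v x 3 - v x 0 * u x 3 = u x 1 * v x 2 - v x 1 * u x 2 := by
    intro x
    have hconst : ∀ y, HasDerivAt (fun x => (u x 0 * v x 3 - v x 0 * u x 3) -
        (u x 1 * v x 2 - v x 1 * u x 2)) 0 y := fun y =>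
      ((hmin 0 3 y).sub (hmin 1 2 y)).congr_deriv (by simp; ring)
    have := is_const_of_deriv_eq_zero (fun y => (hconst y).differentiableAt)
      (fun y => (hconst y).deriv) x a
    simp [hua, hva] at this
    linarith
  refine ⟨fun x => (hmin 0 1 x).congr_deriv ?_, fun x => (hmin 0 2 x).congr_deriv ?_,
    fun x => (hmin 1 2 x).congr_deriv ?_, fun x => (hmin 1 3 x).congr_deriv ?_,
    fun x => (hmin 2 3 x).congr_deriv ?_, fun x => ?_, ?_, ?_, ?_, ?_, ?_⟩
  · simp; ring
  · simp; linear_combination hiso x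
  · simp; ring
  · simp; ring
  · simp; ring
  · linear_combination -(u x 1 * v x 2 - v x 1 * u x 2) * hiso x
  all_goals simp [hua, hva]

/-- The conjugate points of `a` are the zeros of `u v₁ - v u₁`, where `u` and `v` span the
solutions that vanish at `a` together with `r y''`. -/
theorem conjugateSet_eq {u v : ℝ → Fin 4 → ℝ} (hρc : Continuous ρ) (hpc : Continuous p')
    (hqc : Continuous q') (hu : ∀ x, HasDerivAt u (systemOp ρ p' q' x (u x)) x)
    (hv : ∀ x, HasDerivAt v (systemOp ρ p' q' x (v x)) x)
    (hua : u a = ![0, 1, 0, 0]) (hva : v a = ![0, 0, 0, 1])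
    (hr : ∀ x ∈ Ici a, 0 < r x) (hρ : ∀ x ∈ Ici a, ρ x = 1 / r x)
    (hp : ∀ x ∈ Ici a, p' x = p x) (hq : ∀ x ∈ Ici a, q' x = q x) :
    conjugateSet a r p q = {x | a < x ∧ u x 0 * v x 2 - v x 0 * u x 2 = 0} := by
  have hcomb : ∀ c d : ℝ, ∀ x, HasDerivAt (fun x => c • u x + d • v x)
      (systemOp ρ p' q' x (c • u x + d • v x)) x := fun c d x => by
    rw [map_add, map_smul, map_smul]
    exact ((hu x).const_smul c).add ((hv x).const_smul d)
  ext b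
  refine and_congr_right fun hab => ⟨?_, fun h => ?_⟩
  · rintro ⟨y, hy, ⟨x, hx, hyx⟩, hya, hya1, hyb, hyb1⟩
    set c := der a y a
    set d := quasiT a r q y a
    have hsol : ∀ t ∈ Ici a, quasiVec a r q y t - (c • u t + d • v t) = 0 := by
      refine eq_zero_of_hasDerivWithinAt_linear (continuous_systemOp hρc hpc hqc)
        (fun t ht => ?_) ?_
      · rw [map_sub]
        exact (hy.hasDerivWithinAt_quasiVec hr hρ hp hq ht).sub (hcomb c d t).hasDerivWithinAt
      · ext i
        fin_cases i <;> simp [quasiVec, hua, hva, hya, hya1, c, d]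
    have hcoord : ∀ t ∈ Ici a, ∀ i, quasiVec a r q y t i = c * u t i + d * v t i := by
      intro t ht i
      simpa using congrFun (sub_eq_zero.1 (hsol t ht)) i
    have e0 : c * u b 0 + d * v b 0 = 0 := (hcoord b hab.le 0).symm.trans hyb
    have e2 : c * u b 2 + d * v b 2 = 0 := (hcoord b hab.le 2).symm.trans hyb1
    have ec : c * (u b 0 * v b 2 - v b 0 * u b 2) = 0 := by
      linear_combination v b 2 * e0 - v b 0 * e2
    have ed : d * (u b 0 * v b 2 - v b 0 * u b 2) = 0 := by
      linear_combination u b 0 * e2 - u b 2 * e0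
    by_contra hne
    have hc := (mul_eq_zero.1 ec).resolve_right hne
    have hd := (mul_eq_zero.1 ed).resolve_right hne
    have hyx' : y x = c * u x 0 + d * v x 0 := hcoord x hx 0
    rw [hc, hd] at hyx'
    exact hyx (by simpa using hyx')
  · obtain ⟨c, d, hcd, e0, e2⟩ : ∃ c d : ℝ, (c ≠ 0 ∨ d ≠ 0) ∧ c * u b 0 + d * v b 0 = 0 ∧
        c * u b 2 + d * v b 2 = 0 := by
      have hdet : (!![u b 0, v b 0; u b 2, v b 2] : Matrix (Fin 2) (Fin 2) ℝ).det = 0 := by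
        rw [Matrix.det_fin_two_of]; exact h
      obtain ⟨w, hw, hw0⟩ := Matrix.exists_mulVec_eq_zero_iff.2 hdet
      refine ⟨w 0, w 1, ?_, ?_, ?_⟩
      · by_contra! hn
        exact hw (by ext i; fin_cases i <;> simp [hn.1, hn.2])
      · have := congrFun hw0 0
        simp [Matrix.mulVec, dotProduct, Fin.sum_univ_two] at this
        linarith
      · have := congrFun hw0 1
        simp [Matrix.mulVec, dotProduct, Fin.sum_univ_two] at this
        linarith
    obtain ⟨hsol, hvec⟩ := isSolution_of_hasDerivAt (hcomb c d) hr hρ hp hq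
    have hcoord : ∀ t ∈ Ici a, ∀ i, quasiVec a r q (fun x => (c • u x + d • v x) 0) t i =
        c * u t i + d * v t i := by
      intro t ht i
      simpa using congrFun (hvec ht) i
    refine ⟨_, hsol, ?_, by simp [hua, hva], ?_, by simpa using e0, ?_⟩
    -- If `y` vanished identically, so would its quasi-derivatives; but `y'` and `T y` at `a` are
    -- `c` and `d`, which are not both zero.
    · by_contra! hzero
      have hd0 : EqOn (fun x => (c • u x + d • v x) 0) 0 (Ici a) := fun x hx => hzero x hx
      have hd1 : EqOn (der a fun x => (c • u x + d • v x) 0) 0 (Ici a) := fun x hx => by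
        simp only [der]
        rw [derivWithin_congr hd0 (hd0 hx)]
        simp
      have hd2 : EqOn (quasiOne a r fun x => (c • u x + d • v x) 0) 0 (Ici a) := fun x hx => by
        simp only [quasiOne]
        rw [der, derivWithin_congr hd1 (hd1 hx)]
        simp
      have h1 := hcoord a self_mem_Ici 1
      have h3 := hcoord a self_mem_Ici 3
      have hT : quasiT a r q (fun x => (c • u x + d • v x) 0) a = 0 := by
        rw [quasiT, hd1 self_mem_Ici, der, derivWithin_congr hd2 (hd2 self_mem_Ici)]
        simp
      have h1' : quasiVec a r q (fun x => (c • u x + d • v x) 0) a 1 = 0 := hd1 self_mem_Ici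
      have h3' : quasiVec a r q (fun x => (c • u x + d • v x) 0) a 3 = 0 := hT
      rw [h1'] at h1
      rw [h3'] at h3
      simp [hua, hva] at h1 h3
      rcases hcd with hc | hd
      · exact hc h1.symm
      · exact hd h3.symm
    · refine (hcoord a self_mem_Ici 2).trans ?_
      simp [hua, hva]
    · exact (hcoord b hab.le 2).trans e2

/-- A function continuous on `[a, ∞)` is extended by a constant to the left of `a`. -/
theorem continuous_comp_max {f : ℝ → ℝ} (hf : ContinuousOn f (Ici a)) :
    Continuous fun x => f (max a x) :=
  hf.comp_continuous (by fun_prop) fun x => le_max_left a x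

end FourthOrder

theorem mainTheorem6 (a : ℝ) (ha : 0 ≤ a) (r p q : ℝ → ℝ)
    (hr : ContinuousOn r (Set.Ici a)) (hp : ContinuousOn p (Set.Ici a))
    (hq : ContinuousOn q (Set.Ici a))
    (hr_pos : ∀ x ∈ Set.Ici a, 0 < r x) (hp_pos : ∀ x ∈ Set.Ici a, 0 < p x)
    (hr_int : Filter.Tendsto (fun x : ℝ => ∫ t in a..x, 1 / r t) Filter.atTop Filter.atTop)
    (hq_int : Filter.Tendsto (fun x : ℝ => ∫ t in a..x, q t) Filter.atTop Filter.atBot) :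
    FourthOrder.SystemsConjugate a r p q := by
  have hmax : ∀ x ∈ Set.Ici a, max a x = x := fun x hx => max_eq_right hx
  have hmem : ∀ x, max a x ∈ Set.Ici a := fun x => le_max_left a x
  -- Composing with `max a` extends the coefficients continuously to the whole line, so two-sided
  -- derivatives can be used throughout; nothing changes on `[a, ∞)`.
  have hρc : Continuous fun x => 1 / r (max a x) :=
    continuous_const.div (FourthOrder.continuous_comp_max hr) fun x => (hr_pos _ (hmem x)).ne'
  have hpc := FourthOrder.continuous_comp_max hp
  have hqc := FourthOrder.continuous_comp_max hq
  have hA := FourthOrder.continuous_systemOp hρc hpc hqc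
  obtain ⟨u, hua, hu⟩ := FourthOrder.exists_hasDerivAt_linear a hA ![0, 1, 0, 0]
  obtain ⟨v, hva, hv⟩ := FourthOrder.exists_hasDerivAt_linear a hA ![0, 0, 0, 1]
  have hprim : ∀ f : ℝ → ℝ, (fun x => ∫ t in a..x, f t) =ᶠ[Filter.atTop]
      fun x => ∫ t in a..x, f (max a t) := by
    intro f
    filter_upwards [Filter.eventually_ge_atTop a] with x hx
    refine intervalIntegral.integral_congr fun t ht => ?_
    rw [Set.uIcc_of_le hx] at ht
    simp only [hmax t ht.1]
  obtain ⟨η, hη⟩ := (FourthOrder.minorSystem_of_hasDerivAt hu hv hua hva).exists_zero hρc hpc hqc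
    (fun x => one_div_pos.2 (hr_pos _ (hmem x))) (fun x => hp_pos _ (hmem x))
    (fun x => (hqc.integral_hasStrictDerivAt a x).hasDerivAt)
    (fun x => (hρc.integral_hasStrictDerivAt a x).hasDerivAt)
    intervalIntegral.integral_same (hq_int.congr' (hprim q))
    (hr_int.congr' (hprim fun t => 1 / r t))
  refine ⟨η, ?_⟩
  rw [FourthOrder.IsSystemsConjugatePoint, FourthOrder.conjugateSet_eq hρc hpc hqc hu hv hua hva
    hr_pos (fun x hx => by rw [hmax x hx]) (fun x hx => by rw [hmax x hx])
    (fun x hx => by rw [hmax x hx])]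
  exact hη
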